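/- Let $P_s,N_0,d_1,d_2,\eta>0$, $m\in\mathbb R$, $0<\alpha<1$ and $\lambda_s,\lambda_d,\lambda_r>0$, and put $k=\frac{\eta\alpha}{1-\alpha}$ and $a=\frac{P_s}{N_0d_1^md_2^m}$. Let $h_1,h_2,g,\hat f$ be complex channel coefficients such that $|h_1|^2,|h_2|^2,|g|^2,|\hat f|^2$ are independent and exponentially distributed with means $\lambda_s,\lambda_s,\lambda_d,\lambda_r$, respectively. For full-duplex amplify-and-forward relaying with dual-antenna energy harvesting in the interference-dominated scenario, the end-to-end SINR is $$\gamma_{\sf AF}=\frac{\frac{P_s|h_1|^2|g|^2}{|\hat f|^2d_1^md_2^m}}{\frac{N_0|h_1|^2(1-\alpha)}{\eta\alpha(|h_1|^2+|h_2|^2)|\hat f|^2}+\frac{\eta\alpha P_s(|h_1|^2+|h_2|^2)|g|^2}{(1-\alpha)d_1^md_2^m}+N_0}.$$ For $x>0$ let $G_{3,1}^{1,3}\left(x\left|{}_{1}^{-1,1,1}\right.\right)$ be the Meijer G-function $$G_{3,1}^{1,3}\left(x\left|{}_{1}^{-1,1,1}\right.\right)=\frac{1}{2\pi i}\int_{c-i\infty}^{c+i\infty}\Gamma(1-s)\,\Gamma(2+s)\,\Gamma(s)^2\,x^s\,ds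 ,\qquad 0<c<1,$$ where the integral converges absolutely and does not depend on $c$. Then the ergodic capacity $R_{\sf E}^{\sf AF}={\tt E}\{\log_2(1+\gamma_{\sf AF})\}$ is finite and $$R_{\sf E}^{\sf AF}=\frac{1}{\ln 2}G_{3,1}^{1,3}\left(ka\lambda_s\lambda_d\left|{}_{1}^{-1,1,1}\right.\right)-\frac{1}{\ln 2}\int_0^\infty G_{3,1}^{1,3}\left(\frac{ka\lambda_s\lambda_d}{1+t/k}\left|{}_{1}^{-1,1,1}\right.\right)\left(\lambda_r-\left(\lambda_r+\frac1t\right)e^{-\frac{1}{\lambda_r t}}\right)dt,$$ where the integral converges absolutely. -/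

import Mathlib

open MeasureTheory ProbabilityTheory Set

noncomputable section

/-- The integrand `∏_{j ≤ m} Γ(b_j - s) ∏_{j ≤ n} Γ(1 - a_j + s) /
(∏_{j > m} Γ(1 - b_j + s) ∏_{j > n} Γ(a_j - s)) · z ^ s` of the Mellin–Barnes integral of
`G^{m,n}_{p,q}(z | a ; b)`. -/
def meijerIntegrand (m n : ℕ) {p q : ℕ} (a : Fin p → ℂ) (b : Fin q → ℂ) (z s : ℂ) : ℂ :=
  (∏ j : Fin q, if (j : ℕ) < m then Complex.Gamma (b j - s)
      else (Complex.Gamma (1 - b j + s))⁻¹) *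
    (∏ j : Fin p, if (j : ℕ) < n then Complex.Gamma (1 - a j + s)
      else (Complex.Gamma (a j - s))⁻¹) * z ^ s

/-- The vertical line `Re s = c` separates the poles `b_j + l` of the `Γ(b_j - s)`, `j ≤ m`, which
lie to its right, from the poles `a_j - 1 - l` of the `Γ(1 - a_j + s)`, `j ≤ n`, which lie to its
left. -/
def IsMeijerLine (m n : ℕ) {p q : ℕ} (a : Fin p → ℂ) (b : Fin q → ℂ) (c : ℝ) : Prop :=
  (∀ j : Fin q, (j : ℕ) < m → c < (b j).re) ∧ (∀ j : Fin p, (j : ℕ) < n → (a j).re - 1 < c)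

/-- `G^{m,n}_{p,q}(z | a ; b)` has the value `v`: there is a vertical line separating the two
families of poles, and along every such line `L`, directed upwards, the Mellin–Barnes integral
`1 / (2 π i) ∫_L` converges absolutely and equals `v`. -/
def HasMeijerG (m n : ℕ) {p q : ℕ} (a : Fin p → ℂ) (b : Fin q → ℂ) (z v : ℂ) : Prop :=
  (∃ c : ℝ, IsMeijerLine m n a b c) ∧
    ∀ c : ℝ, IsMeijerLine m n a b c →
      Integrable (fun τ : ℝ => meijerIntegrand m n a b z (c + τ * Complex.I)) ∧
      1 / (2 * Real.pi * Complex.I) *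
        ∫ τ : ℝ, meijerIntegrand m n a b z (c + τ * Complex.I) * Complex.I = v

open Classical in
/-- The Meijer function `G^{m,n}_{p,q}(z | a ; b)`, with the value `0` where no value is given by
absolutely convergent Mellin–Barnes integrals along separating vertical lines. The numbers `p` and
`q` are the lengths of `a` and `b`. -/
def meijerG (m n : ℕ) {p q : ℕ} (a : Fin p → ℂ) (b : Fin q → ℂ) (z : ℂ) : ℂ :=
  if h : ∃ v, HasMeijerG m n a b z v then h.choose else 0

/-- `k = η α / (1 - α)`. -/
def harvestRatio (η α : ℝ) : ℝ := η * α / (1 - α)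

/-- End-to-end SINR of full-duplex amplify-and-forward relaying with dual-antenna energy harvesting
in the interference dominated scenario, as a function of the channel power gains
`x₁ = |h₁|²`, `x₂ = |h₂|²`, `y = |g|²`, `z = |f̂|²`. -/
def sinrAF (Ps N₀ d₁ d₂ m η α x₁ x₂ y z : ℝ) : ℝ :=
  (Ps * x₁ * y / (z * d₁ ^ m * d₂ ^ m)) /
    (N₀ * x₁ * (1 - α) / (η * α * (x₁ + x₂) * z) +
      η * α * Ps * (x₁ + x₂) * y / ((1 - α) * d₁ ^ m * d₂ ^ m) + N₀)

/-- The density on `(0, ∞)` of `T = |h₁|² / ((|h₁|² + |h₂|²) |f̂|²)`. -/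
def densityT (lr t : ℝ) : ℝ :=
  lr - (lr + 1 / t) * Real.exp (-(1 / (lr * t)))

end

/-! With W = k a (|h₁|² + |h₂|²) |g|² and T = |h₁|² / ((|h₁|² + |h₂|²) |f̂|²), the SINR satisfies 1
+ γ = (1 + W) / (1 + W / (1 + T / k)) (`one_add_sinrAF`), so log (1 + γ) is a difference of two
logarithms of the same shape. For i.i.d. exponential X₁, X₂ the sum X₁ + X₂ and the fraction X₁ /
(X₁ + X₂) are independent and the fraction is uniform; hence X₁ + X₂, |g|² and T are independent,
and T has density `densityT` (`lintegral_sum_gain_ratio`). Conditionally on T = t, both logarithms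
have means of the form `meanLog x` = E log (1 + x S V), with S of law Gamma(2), V standard
exponential, and x = k a λ_s λ_d or that number divided by 1 + t / k.

It remains to see that `meanLog` is the Meijer function (`hasMeijerG_meanLog`). Mellin inversion
writes log (1 + x) as an integral of Γ(s) Γ(1 - s) / s · x^s over a vertical line; replacing x by x
S V and taking expectations under the integral sign inserts the moments E V^s = Γ(s + 1) and E S^s =
Γ(s + 2), which produces the Mellin–Barnes integrand. Finiteness comes from log (1 + u) ≤ u for the
first logarithm and from domination by the first for the second. -/

/-! ### Changes of variables for exponential densities -/

theorem lintegral_image_mul_left {l : ℝ} (hl : 0 < l) {s : Set ℝ} (hs : MeasurableSet s)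
    (F : ℝ → ENNReal) :
    ∫⁻ x in (fun u => l * u) '' s, F x = ENNReal.ofReal l * ∫⁻ u in s, F (l * u) := by
  rw [lintegral_image_eq_lintegral_abs_deriv_mul hs (f' := fun _ => l)
    (fun x _ => by simpa using ((hasDerivAt_id x).const_mul l).hasDerivWithinAt)
    (fun x _ y _ h => mul_left_cancel₀ hl.ne' h), abs_of_pos hl,
    lintegral_const_mul' _ _ ENNReal.ofReal_ne_top]

theorem lintegral_Ioi_mul_left {l : ℝ} (hl : 0 < l) (F : ℝ → ENNReal) :
    ∫⁻ x in Ioi 0, F x = ENNReal.ofReal l * ∫⁻ u in Ioi 0, F (l * u) := by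
  rw [← lintegral_image_mul_left hl measurableSet_Ioi, Set.image_mul_left_Ioi hl, mul_zero]

theorem lintegral_Ioo_mul_left {l c : ℝ} (hl : 0 < l) (F : ℝ → ENNReal) :
    ∫⁻ x in Ioo 0 (l * c), F x = ENNReal.ofReal l * ∫⁻ u in Ioo 0 c, F (l * u) := by
  rw [← lintegral_image_mul_left hl measurableSet_Ioo, Set.image_mul_left_Ioo hl, mul_zero]

theorem lintegral_expMeasure_one_div {l : ℝ} (hl : 0 < l) {F : ℝ → ENNReal} (hF : Measurable F) :
    ∫⁻ x, F x ∂expMeasure (1 / l) =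
      ∫⁻ u in Ioi 0, ENNReal.ofReal (Real.exp (-u)) * F (l * u) := by
  have h1 : expMeasure (1 / l) = volume.withDensity (exponentialPDF (1 / l)) := rfl
  rw [h1, lintegral_withDensity_eq_lintegral_mul _
    (by exact (measurable_exponentialPDFReal _).ennreal_ofReal) hF]
  have h2 : ∫⁻ x, (exponentialPDF (1 / l) * F) x =
      ∫⁻ x in Ici 0, (exponentialPDF (1 / l) * F) x := by
    refine (setLIntegral_eq_of_support_subset fun x hx => ?_).symm
    by_contra h
    exact hx (by simp [exponentialPDF_of_neg (not_le.1 h)])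
  rw [h2, setLIntegral_congr Ioi_ae_eq_Ici.symm, lintegral_Ioi_mul_left hl,
    ← lintegral_const_mul' _ _ ENNReal.ofReal_ne_top]
  refine setLIntegral_congr_fun measurableSet_Ioi fun u hu => ?_
  have hu' : (0 : ℝ) < u := hu
  simp only [Pi.mul_apply]
  rw [exponentialPDF_of_nonneg (by positivity), ← mul_assoc, ← ENNReal.ofReal_mul hl.le]
  congr 2
  field_simp

/-- The change of variables `x = s u`, `y = s (1 - u)` on the open quadrant. -/
theorem lintegral_quadrant_polar {F : ℝ → ℝ → ENNReal} (hF : Measurable (Function.uncurry F)) :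
    ∫⁻ x in Ioi 0, ∫⁻ y in Ioi 0, F x y =
      ∫⁻ s in Ioi 0, ENNReal.ofReal s * ∫⁻ u in Ioo 0 1, F (s * u) (s * (1 - u)) := by
  -- Put s = x + y. The constraint y > 0 becomes s > x, kept as an indicator so that the order of
  -- integration can be swapped.
  have h1 (x : ℝ) : ∫⁻ y in Ioi 0, F x y = ∫⁻ s, (Ioi x).indicator (fun s => F x (s - x)) s := by
    rw [← lintegral_indicator measurableSet_Ioi,
      ← lintegral_sub_right_eq_self _ x]
    refine lintegral_congr fun s => ?_
    simp [indicator]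
  have hm : Measurable (Function.uncurry fun x s => (Ioi x).indicator (fun s => F x (s - x)) s) := by
    have : (Function.uncurry fun x s => (Ioi x).indicator (fun s => F x (s - x)) s) =
        {p : ℝ × ℝ | p.1 < p.2}.indicator (fun p => Function.uncurry F (p.1, p.2 - p.1)) := by
      ext ⟨x, s⟩
      simp [indicator]
    rw [this]
    exact (hF.comp (by fun_prop)).indicator (measurableSet_lt measurable_fst measurable_snd)
  simp_rw [h1]
  rw [lintegral_lintegral_swap hm.aemeasurable, ← lintegral_indicator measurableSet_Ioi]
  refine lintegral_congr fun s => ?_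
  rw [← lintegral_indicator measurableSet_Ioi]
  rcases le_or_gt s 0 with hs | hs
  · rw [indicator_of_notMem (by simpa using hs)]
    refine lintegral_eq_zero_of_ae_eq_zero (Filter.Eventually.of_forall fun x => ?_)
    by_cases hx : 0 < x
    · simp [hx, (hs.trans hx.le)]
    · simp [hx]
  · rw [indicator_of_mem (by simpa using hs)]
    have h3 := lintegral_Ioo_mul_left (c := 1) hs (fun x => F x (s - x))
    rw [mul_one] at h3
    simp only [mul_sub, mul_one]
    rw [← h3, ← lintegral_indicator measurableSet_Ioo]
    refine lintegral_congr fun x => ?_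
    by_cases hx : 0 < x <;> by_cases hx' : x < s <;> simp [indicator, hx, hx']

theorem lintegral_Ioo_mul_exp_neg {b : ℝ} (hb : 0 < b) :
    ∫⁻ w in Ioo 0 b, ENNReal.ofReal (w * Real.exp (-w)) =
      ENNReal.ofReal (1 - (1 + b) * Real.exp (-b)) := by
  have hd (w : ℝ) : HasDerivAt (fun w => -((1 + w) * Real.exp (-w))) (w * Real.exp (-w)) w := by
    refine (((hasDerivAt_id' w).const_add 1).mul (hasDerivAt_neg w).exp).neg.congr_deriv ?_
    ring
  rw [setLIntegral_congr Ioo_ae_eq_Ioc, ← ofReal_integral_eq_lintegral_ofReal,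
    ← intervalIntegral.integral_of_le hb.le, intervalIntegral.integral_eq_sub_of_hasDerivAt
      (fun w _ => hd w) (Continuous.intervalIntegrable (by fun_prop) _ _)]
  · congr 1
    simp
    ring
  · exact ((Continuous.integrableOn_Icc (by fun_prop)).mono_set Ioc_subset_Icc_self)
  · filter_upwards [ae_restrict_mem measurableSet_Ioc] with w hw
    have := hw.1
    positivity

/-- The law of `U / Z`, where `U` is uniform on `(0, 1)` and `Z` is exponential with mean `l`. -/
theorem lintegral_uniform_div_exp {l : ℝ} (hl : 0 < l) {F : ℝ → ENNReal} (hF : Measurable F) :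
    ∫⁻ w in Ioi 0, ENNReal.ofReal (Real.exp (-w)) * ∫⁻ u in Ioo 0 1, F (u / (l * w)) =
      ∫⁻ t in Ioi 0, ENNReal.ofReal (densityT l t) * F t := by
  -- Substituting u = l w t turns u < 1 into t < 1 / (l w). After the swap the same constraint reads
  -- w < 1 / (l t), leaving a truncated Gamma(2) integral, which is the source of the form of
  -- `densityT`.
  have h1 (w : ℝ) (hw : w ∈ Ioi (0 : ℝ)) :
      ENNReal.ofReal (Real.exp (-w)) * ∫⁻ u in Ioo 0 1, F (u / (l * w)) =
      ∫⁻ t in Ioi 0, ENNReal.ofReal (l * (w * Real.exp (-w))) *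
        (Iio (1 / (l * w))).indicator F t := by
    have hw' : (0 : ℝ) < w := hw
    have hlw : 0 < l * w := by positivity
    have h2 := lintegral_Ioo_mul_left (c := 1 / (l * w)) hlw (fun u => F (u / (l * w)))
    rw [mul_one_div_cancel hlw.ne'] at h2
    rw [h2, lintegral_const_mul' _ _ ENNReal.ofReal_ne_top, ← mul_assoc,
      ← ENNReal.ofReal_mul (by positivity), setLIntegral_indicator measurableSet_Iio,
      inter_comm, Ioi_inter_Iio]
    congr 2
    · ring
    · ext t
      rw [mul_div_cancel_left₀ _ hlw.ne']
  rw [setLIntegral_congr_fun measurableSet_Ioi h1, lintegral_lintegral_swap]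
  · refine setLIntegral_congr_fun measurableSet_Ioi fun t ht => ?_
    have ht' : (0 : ℝ) < t := ht
    have h3 (w : ℝ) (hw : w ∈ Ioi (0 : ℝ)) : ENNReal.ofReal (l * (w * Real.exp (-w))) *
        (Iio (1 / (l * w))).indicator F t = ENNReal.ofReal l * F t *
          (Iio (1 / (l * t))).indicator (fun w => ENNReal.ofReal (w * Real.exp (-w))) w := by
      have hw' : (0 : ℝ) < w := hw
      have : t < 1 / (l * w) ↔ w < 1 / (l * t) := by
        rw [lt_div_iff₀ (by positivity), lt_div_iff₀ (by positivity)]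
        ring_nf
      by_cases h : t < 1 / (l * w)
      · rw [indicator_of_mem (show t ∈ Iio _ from h),
          indicator_of_mem (show w ∈ Iio _ from this.1 h), ENNReal.ofReal_mul hl.le]
        ring
      · rw [indicator_of_notMem (show t ∉ Iio _ from h),
          indicator_of_notMem (show w ∉ Iio _ from fun h' => h (this.2 h')), mul_zero, mul_zero]
    rw [setLIntegral_congr_fun measurableSet_Ioi h3, lintegral_const_mul _
      (Measurable.indicator (by fun_prop) measurableSet_Iio),
      setLIntegral_indicator measurableSet_Iio, inter_comm, Ioi_inter_Iio,
      lintegral_Ioo_mul_exp_neg (by positivity), mul_right_comm, ← ENNReal.ofReal_mul hl.le]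
    congr 2
    unfold densityT
    field_simp
  · refine Measurable.aemeasurable ?_
    have : (Function.uncurry fun w t => ENNReal.ofReal (l * (w * Real.exp (-w))) *
        (Iio (1 / (l * w))).indicator F t) = fun p : ℝ × ℝ =>
          ENNReal.ofReal (l * (p.1 * Real.exp (-p.1))) *
            {p : ℝ × ℝ | p.2 < 1 / (l * p.1)}.indicator (fun p => F p.2) p := by
      ext ⟨x, s⟩
      simp [indicator]
    rw [this]
    exact Measurable.mul (by fun_prop) ((hF.comp measurable_snd).indicator
      (measurableSet_lt measurable_snd (by fun_prop)))

/-! ### Independence and laws of the sum, the gain and the ratio -/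

noncomputable section

/-- The law of a standard exponential variable. -/
def stdExpMeasure : Measure ℝ :=
  (volume.restrict (Ioi 0)).withDensity fun u => ENNReal.ofReal (Real.exp (-u))

/-- The law of the sum of two independent standard exponential variables. -/
def stdGammaTwoMeasure : Measure ℝ :=
  (volume.restrict (Ioi 0)).withDensity fun s => ENNReal.ofReal (s * Real.exp (-s))

/-- The measure on `(0, ∞)` with density `densityT l`. -/
def ratioMeasure (l : ℝ) : Measure ℝ :=
  (volume.restrict (Ioi 0)).withDensity fun t => ENNReal.ofReal (densityT l t)

instance : SFinite stdExpMeasure := by unfold stdExpMeasure; infer_instance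
instance : SFinite stdGammaTwoMeasure := by unfold stdGammaTwoMeasure; infer_instance
instance (l : ℝ) : SFinite (ratioMeasure l) := by unfold ratioMeasure; infer_instance

@[fun_prop]
theorem measurable_densityT (l : ℝ) : Measurable (densityT l) := by
  unfold densityT
  fun_prop

theorem lintegral_stdExpMeasure {F : ℝ → ENNReal} (hF : Measurable F) :
    ∫⁻ u, F u ∂stdExpMeasure = ∫⁻ u in Ioi 0, ENNReal.ofReal (Real.exp (-u)) * F u := by
  rw [stdExpMeasure, lintegral_withDensity_eq_lintegral_mul _ (by fun_prop) hF]
  rfl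

theorem lintegral_stdGammaTwoMeasure {F : ℝ → ENNReal} (hF : Measurable F) :
    ∫⁻ u, F u ∂stdGammaTwoMeasure =
      ∫⁻ u in Ioi 0, ENNReal.ofReal (u * Real.exp (-u)) * F u := by
  rw [stdGammaTwoMeasure, lintegral_withDensity_eq_lintegral_mul _ (by fun_prop) hF]
  rfl

theorem lintegral_ratioMeasure (l : ℝ) {F : ℝ → ENNReal} (hF : Measurable F) :
    ∫⁻ t, F t ∂ratioMeasure l = ∫⁻ t in Ioi 0, ENNReal.ofReal (densityT l t) * F t := by
  rw [ratioMeasure, lintegral_withDensity_eq_lintegral_mul _ (by fun_prop) hF]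
  rfl

theorem lintegral_expMeasure_eq_stdExpMeasure {l : ℝ} (hl : 0 < l) {F : ℝ → ENNReal}
    (hF : Measurable F) :
    ∫⁻ x, F x ∂expMeasure (1 / l) = ∫⁻ u, F (l * u) ∂stdExpMeasure := by
  rw [lintegral_expMeasure_one_div hl hF, lintegral_stdExpMeasure (by fun_prop)]

/-- For independent standard exponential `X`, `Y`, the sum `X + Y` and the quotient `X / (X + Y)`
are independent, and the quotient is uniform. -/
theorem lintegral_stdExpMeasure_sum_div {H : ℝ → ℝ → ENNReal}
    (hH : Measurable (Function.uncurry H)) :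
    ∫⁻ x, ∫⁻ y, H (x + y) (x / (x + y)) ∂stdExpMeasure ∂stdExpMeasure =
      ∫⁻ s, (∫⁻ u in Ioo 0 1, H s u) ∂stdGammaTwoMeasure := by
  have hH' : Measurable fun p : ℝ × ℝ => H (p.1 + p.2) (p.1 / (p.1 + p.2)) :=
    hH.comp (g := Function.uncurry H) (f := fun p : ℝ × ℝ => (p.1 + p.2, p.1 / (p.1 + p.2)))
      (by fun_prop)
  have h1 (x : ℝ) : ∫⁻ y, H (x + y) (x / (x + y)) ∂stdExpMeasure =
      ∫⁻ y in Ioi 0, ENNReal.ofReal (Real.exp (-y)) * H (x + y) (x / (x + y)) :=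
    lintegral_stdExpMeasure (F := fun y => H (x + y) (x / (x + y)))
      (hH'.comp measurable_prodMk_left)
  have h2 : Measurable fun x => ∫⁻ y, H (x + y) (x / (x + y)) ∂stdExpMeasure :=
    Measurable.lintegral_prod_right' hH'
  rw [lintegral_stdExpMeasure h2]
  simp_rw [h1, ← lintegral_const_mul' _ _ ENNReal.ofReal_ne_top]
  rw [lintegral_quadrant_polar (F := fun x y => ENNReal.ofReal (Real.exp (-x)) *
    (ENNReal.ofReal (Real.exp (-y)) * H (x + y) (x / (x + y))))]
  · rw [lintegral_stdGammaTwoMeasure (F := fun s => ∫⁻ u in Ioo 0 1, H s u)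
      (Measurable.lintegral_prod_right' hH)]
    refine setLIntegral_congr_fun measurableSet_Ioi fun s hs => ?_
    have hs' : (0 : ℝ) < s := hs
    have h3 (u : ℝ) : ENNReal.ofReal (Real.exp (-(s * u))) *
        (ENNReal.ofReal (Real.exp (-(s * (1 - u)))) *
          H (s * u + s * (1 - u)) (s * u / (s * u + s * (1 - u)))) =
        ENNReal.ofReal (Real.exp (-s)) * H s u := by
      rw [← mul_assoc, ← ENNReal.ofReal_mul (Real.exp_pos _).le, ← Real.exp_add]
      have e : s * u + s * (1 - u) = s := by ring
      rw [e, mul_div_cancel_left₀ _ hs'.ne']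
      congr 4
      ring
    simp_rw [h3]
    rw [lintegral_const_mul' _ _ ENNReal.ofReal_ne_top, ← mul_assoc, ← ENNReal.ofReal_mul hs'.le]
  · exact Measurable.mul (by fun_prop) (Measurable.mul (by fun_prop) hH')

theorem lintegral_ratioMeasure_eq {l : ℝ} (hl : 0 < l) {F : ℝ → ENNReal} (hF : Measurable F) :
    ∫⁻ w, (∫⁻ u in Ioo 0 1, F (u / (l * w))) ∂stdExpMeasure = ∫⁻ t, F t ∂ratioMeasure l := by
  rw [lintegral_ratioMeasure l hF, ← lintegral_uniform_div_exp hl hF, lintegral_stdExpMeasure]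
  exact Measurable.lintegral_prod_right' (f := fun p : ℝ × ℝ => F (p.2 / (l * p.1)))
    (hF.comp (by fun_prop))

/-- The joint law is a product of products. The variables X₁, X₂ are innermost so that, for fixed y
and z, their sum and fraction can be taken as new coordinates. -/
theorem lintegral_of_iIndepFun_four {Ω : Type*} [MeasurableSpace Ω] {μ : Measure Ω}
    [IsProbabilityMeasure μ] {X₁ X₂ Y Z : Ω → ℝ} {ν₁ ν₂ ν₃ ν₄ : Measure ℝ}
    (h₁ : HasLaw X₁ ν₁ μ) (h₂ : HasLaw X₂ ν₂ μ) (h₃ : HasLaw Y ν₃ μ) (h₄ : HasLaw Z ν₄ μ)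
    (hind : iIndepFun (![X₁, X₂, Y, Z] : Fin 4 → Ω → ℝ) μ)
    {Φ : (ℝ × ℝ) × ℝ × ℝ → ENNReal} (hΦ : Measurable Φ) :
    ∫⁻ ω, Φ ((Y ω, Z ω), X₁ ω, X₂ ω) ∂μ =
      ∫⁻ y, ∫⁻ z, ∫⁻ x₁, ∫⁻ x₂, Φ ((y, z), x₁, x₂) ∂ν₂ ∂ν₁ ∂ν₄ ∂ν₃ := by
  have hm₁ := h₁.aemeasurable
  have hm₂ := h₂.aemeasurable
  have hm₃ := h₃.aemeasurable
  have hm₄ := h₄.aemeasurable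
  have hm : ∀ i, AEMeasurable ((![X₁, X₂, Y, Z] : Fin 4 → Ω → ℝ) i) μ := by
    intro i
    fin_cases i <;> assumption
  have : IsProbabilityMeasure ν₁ := h₁.map_eq ▸ Measure.isProbabilityMeasure_map hm₁
  have : IsProbabilityMeasure ν₂ := h₂.map_eq ▸ Measure.isProbabilityMeasure_map hm₂
  have : IsProbabilityMeasure ν₃ := h₃.map_eq ▸ Measure.isProbabilityMeasure_map hm₃
  have : IsProbabilityMeasure ν₄ := h₄.map_eq ▸ Measure.isProbabilityMeasure_map hm₄
  have i1 : IndepFun (fun ω => (Y ω, Z ω)) (fun ω => (X₁ ω, X₂ ω)) μ :=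
    hind.indepFun_prodMk_prodMk₀ hm 2 3 0 1 (by decide) (by decide) (by decide) (by decide)
  have i2 : IndepFun Y Z μ := hind.indepFun (i := 2) (j := 3) (by decide)
  have i3 : IndepFun X₁ X₂ μ := hind.indepFun (i := 0) (j := 1) (by decide)
  rw [indepFun_iff_map_prod_eq_prod_map_map (by fun_prop) (by fun_prop)] at i1 i2 i3
  rw [h₁.map_eq, h₂.map_eq] at i3
  rw [h₃.map_eq, h₄.map_eq] at i2
  rw [i2, i3] at i1
  rw [← lintegral_map' (μ := μ) (f := Φ) (g := fun ω => ((Y ω, Z ω), (X₁ ω, X₂ ω)))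
    hΦ.aemeasurable (by fun_prop), i1, lintegral_prod _ hΦ.aemeasurable, lintegral_prod]
  · refine lintegral_congr fun y => lintegral_congr fun z => ?_
    exact lintegral_prod _ (hΦ.comp measurable_prodMk_left).aemeasurable
  · exact (Measurable.lintegral_prod_right' hΦ).aemeasurable

/-- For independent exponential `X₁`, `X₂`, `Y`, `Z` with means `ls`, `ls`, `ld`, `lr`, the
variables `X₁ + X₂`, `Y` and `X₁ / ((X₁ + X₂) Z)` are independent with explicit densities. -/
theorem lintegral_sum_gain_ratio {Ω : Type*} [MeasurableSpace Ω] {μ : Measure Ω}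
    [IsProbabilityMeasure μ] {X₁ X₂ Y Z : Ω → ℝ} {ls ld lr : ℝ}
    (hls : 0 < ls) (hld : 0 < ld) (hlr : 0 < lr)
    (h₁ : HasLaw X₁ (expMeasure (1 / ls)) μ) (h₂ : HasLaw X₂ (expMeasure (1 / ls)) μ)
    (h₃ : HasLaw Y (expMeasure (1 / ld)) μ) (h₄ : HasLaw Z (expMeasure (1 / lr)) μ)
    (hind : iIndepFun (![X₁, X₂, Y, Z] : Fin 4 → Ω → ℝ) μ)
    {Φ : ℝ → ℝ → ℝ → ENNReal} (hΦ : Measurable fun p : ℝ × ℝ × ℝ => Φ p.1 p.2.1 p.2.2) :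
    ∫⁻ ω, Φ (X₁ ω + X₂ ω) (Y ω) (X₁ ω / ((X₁ ω + X₂ ω) * Z ω)) ∂μ =
      ∫⁻ t, ∫⁻ v, ∫⁻ s, Φ (ls * s) (ld * v) t ∂stdGammaTwoMeasure ∂stdExpMeasure
        ∂ratioMeasure lr := by
  have hΦc {α : Type} [MeasurableSpace α] {f g h : α → ℝ} (hf : Measurable f) (hg : Measurable g)
      (hh : Measurable h) : Measurable fun x => Φ (f x) (g x) (h x) :=
    hΦ.comp (hf.prodMk (hg.prodMk hh))
  have := isProbabilityMeasure_expMeasure (one_div_pos.2 hls)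
  have := isProbabilityMeasure_expMeasure (one_div_pos.2 hlr)
  have := isProbabilityMeasure_expMeasure (one_div_pos.2 hld)
  rw [lintegral_of_iIndepFun_four h₁ h₂ h₃ h₄ hind (Φ := fun p => Φ (p.2.1 + p.2.2) p.1.1
    (p.2.1 / ((p.2.1 + p.2.2) * p.1.2))) (hΦc (by fun_prop) (by fun_prop) (by fun_prop))]
  simp only
  have e1 (y z : ℝ) : ∫⁻ x₁, ∫⁻ x₂, Φ (x₁ + x₂) y (x₁ / ((x₁ + x₂) * z))
        ∂expMeasure (1 / ls) ∂expMeasure (1 / ls) =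
      ∫⁻ s, (∫⁻ u in Ioo 0 1, Φ (ls * s) y (u / z)) ∂stdGammaTwoMeasure := by
    rw [← lintegral_stdExpMeasure_sum_div (H := fun s u => Φ (ls * s) y (u / z))
      (hΦc (by fun_prop) (by fun_prop) (by fun_prop)),
      lintegral_expMeasure_eq_stdExpMeasure hls (Measurable.lintegral_prod_right'
        (f := fun p : ℝ × ℝ => Φ (p.1 + p.2) y (p.1 / ((p.1 + p.2) * z)))
        (hΦc (by fun_prop) (by fun_prop) (by fun_prop)))]
    refine lintegral_congr fun x => ?_
    rw [lintegral_expMeasure_eq_stdExpMeasure hls (hΦc (by fun_prop) (by fun_prop) (by fun_prop))]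
    refine lintegral_congr fun x' => ?_
    rw [← mul_add, mul_assoc, mul_div_mul_left _ _ hls.ne', div_div]
  simp_rw [e1]
  have e2 (y : ℝ) : ∫⁻ z, ∫⁻ s, (∫⁻ u in Ioo 0 1, Φ (ls * s) y (u / z)) ∂stdGammaTwoMeasure
        ∂expMeasure (1 / lr) =
      ∫⁻ t, ∫⁻ s, Φ (ls * s) y t ∂stdGammaTwoMeasure ∂ratioMeasure lr := by
    have hm : Measurable fun p : ℝ × ℝ => ∫⁻ u in Ioo 0 1, Φ (ls * p.2) y (u / p.1) :=
      Measurable.lintegral_prod_right' (f := fun q : (ℝ × ℝ) × ℝ => Φ (ls * q.1.2) y (q.2 / q.1.1))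
        (hΦc (by fun_prop) (by fun_prop) (by fun_prop))
    -- The variable s moves outside, so that for fixed s the integrals over z and u combine into the
    -- law of u / z.
    rw [lintegral_lintegral_swap hm.aemeasurable,
      lintegral_lintegral_swap (f := fun t s => Φ (ls * s) y t)
        (hΦc (by fun_prop) (by fun_prop) (by fun_prop)).aemeasurable]
    refine lintegral_congr fun s => ?_
    rw [← lintegral_ratioMeasure_eq hlr (F := fun t => Φ (ls * s) y t)
      (hΦc (by fun_prop) (by fun_prop) (by fun_prop)),
      lintegral_expMeasure_eq_stdExpMeasure hlr (F := fun z => ∫⁻ u in Ioo 0 1, Φ (ls * s) y (u / z))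
        (hm.comp measurable_prodMk_right)]
  simp_rw [e2]
  have hm : Measurable fun p : ℝ × ℝ => ∫⁻ s, Φ (ls * s) p.1 p.2 ∂stdGammaTwoMeasure :=
    Measurable.lintegral_prod_right' (f := fun q : (ℝ × ℝ) × ℝ => Φ (ls * q.2) q.1.1 q.1.2)
      (hΦc (by fun_prop) (by fun_prop) (by fun_prop))
  rw [lintegral_lintegral_swap hm.aemeasurable]
  refine lintegral_congr fun t => ?_
  rw [lintegral_expMeasure_eq_stdExpMeasure hld
    (F := fun y => ∫⁻ s, Φ (ls * s) y t ∂stdGammaTwoMeasure) (hm.comp measurable_prodMk_right)]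

end

/-! ### Mellin transform of log (1 + 1/x) and its inversion -/

theorem integrableOn_rpow_mul_exp_neg_mul {c r : ℝ} (hc : 0 < c) (hr : 0 < r) :
    IntegrableOn (fun t : ℝ => t ^ (c - 1) * Real.exp (-(r * t))) (Ioi 0) := by
  -- A non-integrable function has integral 0 by convention, so the nonzero Gamma value already
  -- gives integrability.
  refine Integrable.of_integral_ne_zero ?_
  rw [Real.integral_rpow_mul_exp_neg_mul_Ioi hc hr]
  have := Real.Gamma_pos_of_pos hc
  positivity

/-- Write 1 / (x + r) as the integral of exp (-t (x + r)) over t > 0 and apply Fubini: the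
x-integral gives Γ(s) t^(-s), and the t-integral then gives Γ(1 - s) r^(s - 1). -/
theorem hasMellin_one_div_add {s : ℂ} (hs0 : 0 < s.re) (hs1 : s.re < 1) {r : ℝ} (hr : 0 < r) :
    HasMellin (fun x : ℝ => (1 / (x + r : ℝ) : ℂ)) s
      (Complex.Gamma s * Complex.Gamma (1 - s) * (r : ℂ) ^ (s - 1)) := by
  set φ : ℝ × ℝ → ℂ := fun p => (p.2 : ℂ) ^ (s - 1) * Complex.exp (-(p.1 * p.2)) *
    Complex.exp (-(p.1 * r)) with hφ
  have hn (t x : ℝ) (hx : x ∈ Ioi (0 : ℝ)) : ‖φ (t, x)‖ =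
      x ^ (s.re - 1) * Real.exp (-(t * x)) * Real.exp (-(r * t)) := by
    simp only [hφ, norm_mul, Complex.norm_cpow_eq_rpow_re_of_pos hx, Complex.norm_exp]
    simp [mul_comm]
  have hi : Integrable φ ((volume.restrict (Ioi 0)).prod (volume.restrict (Ioi 0))) := by
    have hm : Measurable φ := by
      rw [hφ]
      fun_prop
    rw [integrable_prod_iff hm.aestronglyMeasurable]
    constructor
    · filter_upwards [ae_restrict_mem measurableSet_Ioi] with t ht
      rw [← integrable_norm_iff (f := fun x => φ (t, x)) (hm.comp measurable_prodMk_left).aestronglyMeasurable]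
      exact IntegrableOn.congr_fun
        ((integrableOn_rpow_mul_exp_neg_mul hs0 ht).mul_const (Real.exp (-(r * t)))) (fun x hx => (hn t x hx).symm) measurableSet_Ioi
    · have h1 (t : ℝ) (ht : t ∈ Ioi (0 : ℝ)) :
          Real.Gamma s.re * (t ^ ((1 - s.re) - 1) * Real.exp (-(r * t))) =
          ∫ x in Ioi 0, ‖φ (t, x)‖ := by
        have ht' : (0 : ℝ) < t := ht
        rw [setIntegral_congr_fun measurableSet_Ioi (hn t), integral_mul_const,
          Real.integral_rpow_mul_exp_neg_mul_Ioi hs0 ht, one_div, Real.inv_rpow ht'.le,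
          ← Real.rpow_neg ht'.le]
        ring_nf
      exact IntegrableOn.congr_fun
        ((integrableOn_rpow_mul_exp_neg_mul (by linarith) hr).const_mul _) h1 measurableSet_Ioi
  have h2 (x : ℝ) (hx : x ∈ Ioi (0 : ℝ)) : ∫ t in Ioi 0, φ (t, x) =
      (x : ℂ) ^ (s - 1) • (1 / (x + r : ℝ) : ℂ) := by
    have hx' : (0 : ℝ) < x := hx
    have e (t : ℝ) : φ (t, x) = (x : ℂ) ^ (s - 1) * Complex.exp (-((x + r : ℝ) : ℂ) * t) := by
      simp only [hφ]
      rw [mul_assoc, ← Complex.exp_add]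
      congr 2
      push_cast
      ring
    simp_rw [e]
    rw [integral_const_mul, integral_exp_mul_complex_Ioi (by
      simp only [Complex.neg_re, Complex.ofReal_re]; linarith)]
    rw [Complex.ofReal_zero, mul_zero, Complex.exp_zero, neg_div_neg_eq, smul_eq_mul]
  have h3 (t : ℝ) (ht : t ∈ Ioi (0 : ℝ)) : ∫ x in Ioi 0, φ (t, x) =
      Complex.Gamma s * ((t : ℂ) ^ ((1 - s) - 1) * Complex.exp (-(r * t))) := by
    have ht' : (0 : ℝ) < t := ht
    simp only [hφ]
    rw [integral_mul_const, Complex.integral_cpow_mul_exp_neg_mul_Ioi hs0 (by simpa using ht'),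
      one_div, Complex.inv_cpow _ _ (by
        rw [Complex.arg_ofReal_of_nonneg ht'.le]; exact Real.pi_pos.ne), ← Complex.cpow_neg]
    ring_nf
  constructor
  · exact IntegrableOn.congr_fun hi.integral_prod_right h2 measurableSet_Ioi
  · rw [mellin, ← setIntegral_congr_fun measurableSet_Ioi h2,
      ← integral_integral_swap (f := fun t x => φ (t, x)) hi,
      setIntegral_congr_fun measurableSet_Ioi h3,
      integral_const_mul, Complex.integral_cpow_mul_exp_neg_mul_Ioi (by simpa using hs1)
        (by simpa using hr), one_div, Complex.inv_cpow _ _ (by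
        rw [Complex.arg_ofReal_of_nonneg hr.le]; exact Real.pi_pos.ne), ← Complex.cpow_neg]
    ring_nf

/-- Since log (1 + 1/x) is the integral of 1 / (x + r) over 0 < r ≤ 1, the preceding transform can
be integrated in r; the factor 1 / s is the integral of r^(s - 1). -/
theorem hasMellin_log_one_add_inv {s : ℂ} (hs0 : 0 < s.re) (hs1 : s.re < 1) :
    HasMellin (fun x : ℝ => (Real.log (1 + x⁻¹) : ℂ)) s
      (Complex.Gamma s * Complex.Gamma (1 - s) / s) := by
  set φ : ℝ × ℝ → ℂ := fun p => (p.2 : ℂ) ^ (s - 1) * (1 / (p.2 + p.1 : ℝ) : ℂ) with hφ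
  -- The norm is the same integrand at the real exponent Re s, so the absolute integral needed for
  -- Fubini is again given by `hasMellin_one_div_add`.
  have hn (r : ℝ) (hr : r ∈ Ioc (0 : ℝ) 1) (x : ℝ) (hx : x ∈ Ioi (0 : ℝ)) : (‖φ (r, x)‖ : ℂ) =
      (x : ℂ) ^ ((s.re : ℂ) - 1) • (1 / (x + r : ℝ) : ℂ) := by
    have hx' : (0 : ℝ) < x := hx
    have hr' : (0 : ℝ) < r := hr.1
    simp only [hφ, norm_mul, Complex.norm_cpow_eq_rpow_re_of_pos hx, norm_div, norm_one,
      Complex.norm_real, Real.norm_of_nonneg (add_pos hx' hr').le]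
    rw [Complex.ofReal_mul, Complex.ofReal_cpow hx'.le]
    simp
  have hi : Integrable φ ((volume.restrict (Ioc 0 1)).prod (volume.restrict (Ioi 0))) := by
    have hm : Measurable φ := by
      rw [hφ]
      fun_prop
    rw [integrable_prod_iff hm.aestronglyMeasurable]
    constructor
    · filter_upwards [ae_restrict_mem measurableSet_Ioc] with r hr
      exact (hasMellin_one_div_add hs0 hs1 hr.1).1
    · have h1 (r : ℝ) (hr : r ∈ Ioc (0 : ℝ) 1) :
          Real.Gamma s.re * Real.Gamma (1 - s.re) * r ^ (s.re - 1) =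
          ∫ x in Ioi 0, ‖φ (r, x)‖ := by
        have h := (hasMellin_one_div_add (s := s.re) (by simpa) (by simpa) hr.1).2
        rw [mellin, ← setIntegral_congr_fun measurableSet_Ioi (hn r hr), integral_complex_ofReal] at h
        apply Complex.ofReal_injective
        rw [h, Complex.ofReal_mul, Complex.ofReal_mul, Complex.ofReal_cpow hr.1.le,
          ← Complex.Gamma_ofReal, ← Complex.Gamma_ofReal]
        simp
      refine IntegrableOn.congr_fun (Integrable.const_mul ?_ _) h1 measurableSet_Ioc
      exact (intervalIntegrable_iff_integrableOn_Ioc_of_le zero_le_one).1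
        (intervalIntegral.intervalIntegrable_rpow' (by linarith))
  have h2 (x : ℝ) (hx : x ∈ Ioi (0 : ℝ)) : ∫ r in Ioc 0 1, φ (r, x) =
      (x : ℂ) ^ (s - 1) • (Real.log (1 + x⁻¹) : ℂ) := by
    have hx' : (0 : ℝ) < x := hx
    simp only [hφ]
    rw [integral_const_mul, smul_eq_mul]
    congr 1
    have : ∀ r : ℝ, (1 / (x + r : ℝ) : ℂ) = ((1 / (x + r) : ℝ) : ℂ) := by simp
    simp_rw [this]
    rw [integral_complex_ofReal, ← intervalIntegral.integral_of_le zero_le_one,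
      intervalIntegral.integral_comp_add_left (fun y => 1 / y),
      integral_one_div_of_pos (by simpa) (by linarith)]
    congr 2
    field_simp
    simp
  have h3 (r : ℝ) (hr : r ∈ Ioc (0 : ℝ) 1) : ∫ x in Ioi 0, φ (r, x) =
      Complex.Gamma s * Complex.Gamma (1 - s) * (r : ℂ) ^ (s - 1) :=
    (hasMellin_one_div_add hs0 hs1 hr.1).2
  have hs : s ≠ 0 := fun h => by simp [h] at hs0
  constructor
  · exact IntegrableOn.congr_fun hi.integral_prod_right h2 measurableSet_Ioi
  · rw [mellin, ← setIntegral_congr_fun measurableSet_Ioi h2,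
      ← integral_integral_swap (f := fun t x => φ (t, x)) hi,
      setIntegral_congr_fun measurableSet_Ioc h3, integral_const_mul,
      ← intervalIntegral.integral_of_le zero_le_one, integral_cpow (by left; simpa using hs0)]
    simp [hs]
    ring

/-- With u = π|y|, averaging e^u ≥ 1 + u + u²/2 and e^(-u) ≥ 1 - u gives cosh u ≥ 1 + u²/4, and π² ≥
4. Quadratic growth is enough for integrability on vertical lines. -/
theorem one_add_sq_le_cosh_pi_mul (y : ℝ) : 1 + y ^ 2 ≤ Real.cosh (Real.pi * y) := by
  rw [← Real.cosh_abs, abs_mul, abs_of_pos Real.pi_pos, Real.cosh_eq]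
  have h0 : 0 ≤ |y| := abs_nonneg y
  have h1 := Real.quadratic_le_exp_of_nonneg (mul_nonneg Real.pi_pos.le h0)
  have h2 := Real.add_one_le_exp (-(Real.pi * |y|))
  have h3 : y ^ 2 = |y| ^ 2 := (sq_abs y).symm
  have h4 : (9 : ℝ) ≤ Real.pi ^ 2 := by nlinarith [Real.pi_gt_three]
  nlinarith [mul_nonneg (sub_nonneg.2 h4) (sq_nonneg |y|), sq_nonneg |y|]

/-- By reflection the product is π / sin (π (c + iy)), and the sine has real part sin (πc) cosh
(πy). -/
theorem norm_Gamma_mul_Gamma_one_sub_le {c : ℝ} (hc0 : 0 < c) (hc1 : c < 1) (y : ℝ) :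
    ‖Complex.Gamma (c + y * Complex.I) * Complex.Gamma (1 - (c + y * Complex.I))‖ ≤
      Real.pi / Real.sin (Real.pi * c) * (1 + y ^ 2)⁻¹ := by
  have hs : 0 < Real.sin (Real.pi * c) :=
    Real.sin_pos_of_pos_of_lt_pi (by positivity) (by nlinarith [Real.pi_pos])
  rw [Complex.Gamma_mul_Gamma_one_sub, norm_div, Complex.norm_real,
    Real.norm_of_nonneg Real.pi_pos.le, div_mul_eq_mul_div, ← div_eq_mul_inv, div_div,
    mul_comm (1 + y ^ 2)]
  have h1 : Real.sin (Real.pi * c) * (1 + y ^ 2) ≤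
      ‖Complex.sin (Real.pi * (c + y * Complex.I))‖ := by
    refine le_trans ?_ (Complex.re_le_norm _)
    have : (Real.pi : ℂ) * (c + y * Complex.I) =
        ((Real.pi * c : ℝ) : ℂ) + ((Real.pi * y : ℝ) : ℂ) * Complex.I := by
      push_cast; ring
    rw [this, Complex.sin_add_mul_I, ← Complex.ofReal_sin, ← Complex.ofReal_cos,
      ← Complex.ofReal_cosh, ← Complex.ofReal_sinh]
    simp only [Complex.add_re, Complex.mul_re, Complex.ofReal_re, Complex.ofReal_im,
      Complex.I_re, Complex.I_im, Complex.mul_im]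
    nlinarith [mul_le_mul_of_nonneg_left (one_add_sq_le_cosh_pi_mul y) hs.le]
  exact div_le_div_of_nonneg_left Real.pi_pos.le (by positivity) h1

/-- The Mellin transform of `x ↦ log (1 + 1 / x)` is integrable along vertical lines. -/
theorem integrable_Gamma_mul_Gamma_one_sub_div {c : ℝ} (hc0 : 0 < c) (hc1 : c < 1) :
    Integrable fun y : ℝ => Complex.Gamma (c + y * Complex.I) *
      Complex.Gamma (1 - (c + y * Complex.I)) / (c + y * Complex.I) := by
  have hne (y : ℝ) : (c + y * Complex.I : ℂ) ≠ 0 := fun h => by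
    have := congrArg Complex.re h
    simp at this
    exact hc0.ne' this
  have hG (z : ℂ) (hz : 0 < z.re) : ContinuousAt Complex.Gamma z :=
    Complex.continuousAt_Gamma z fun m h => by
      rw [h] at hz
      simp at hz
      linarith [(Nat.cast_nonneg m : (0 : ℝ) ≤ m)]
  have hcont : Continuous fun y : ℝ => Complex.Gamma (c + y * Complex.I) *
      Complex.Gamma (1 - (c + y * Complex.I)) / (c + y * Complex.I) := by
    refine Continuous.div (Continuous.mul ?_ ?_) (by fun_prop) hne
    · refine continuous_iff_continuousAt.2 fun y => ?_
      exact ContinuousAt.comp (f := fun y : ℝ => (c + y * Complex.I : ℂ)) (hG _ (by simpa))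
        (by fun_prop)
    · refine continuous_iff_continuousAt.2 fun y => ?_
      exact ContinuousAt.comp (f := fun y : ℝ => (1 - (c + y * Complex.I) : ℂ))
        (hG _ (by simpa)) (by fun_prop)
  refine (integrable_inv_one_add_sq.const_mul (Real.pi / Real.sin (Real.pi * c) / c)).mono'
    hcont.aestronglyMeasurable (Filter.Eventually.of_forall fun y => ?_)
  have hre : c ≤ ‖(c + y * Complex.I : ℂ)‖ := by
    have := Complex.re_le_norm (c + y * Complex.I : ℂ)
    simpa using this
  rw [norm_div, div_mul_eq_mul_div]
  exact div_le_div₀ ((norm_nonneg _).trans (norm_Gamma_mul_Gamma_one_sub_le hc0 hc1 y))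
    (norm_Gamma_mul_Gamma_one_sub_le hc0 hc1 y) hc0 hre

/-- Mellin inversion of log (1 + 1/·) evaluated at the point 1/x, which turns the kernel (1/x)^(-s)
into x^s. -/
theorem integral_Gamma_mul_Gamma_one_sub_div_mul_cpow {c : ℝ} (hc0 : 0 < c) (hc1 : c < 1)
    {x : ℝ} (hx : 0 < x) :
    ∫ y : ℝ, Complex.Gamma (c + y * Complex.I) * Complex.Gamma (1 - (c + y * Complex.I)) /
      (c + y * Complex.I) * (x : ℂ) ^ (c + y * Complex.I : ℂ) =
      2 * Real.pi * Real.log (1 + x) := by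
  have hM (y : ℝ) : mellin (fun x : ℝ => (Real.log (1 + x⁻¹) : ℂ)) (c + y * Complex.I) =
      Complex.Gamma (c + y * Complex.I) * Complex.Gamma (1 - (c + y * Complex.I)) /
        (c + y * Complex.I) :=
    (hasMellin_log_one_add_inv (by simpa) (by simpa)).2
  have h := mellinInv_mellin_eq c (fun x : ℝ => (Real.log (1 + x⁻¹) : ℂ)) (inv_pos.2 hx)
    (hasMellin_log_one_add_inv (by simpa) (by simpa)).1 (by
      unfold Complex.VerticalIntegrable
      simp_rw [hM]
      exact integrable_Gamma_mul_Gamma_one_sub_div hc0 hc1) (by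
      refine Complex.continuous_ofReal.continuousAt.comp (ContinuousAt.log ?_ ?_)
      · exact continuousAt_const.add (continuousAt_inv₀ (inv_pos.2 hx).ne')
      · rw [inv_inv]
        positivity)
  rw [mellinInv] at h
  simp_rw [hM] at h
  rw [inv_inv] at h
  have e (y : ℝ) (z : ℂ) : ((x⁻¹ : ℝ) : ℂ) ^ (-(c + y * Complex.I) : ℂ) * z =
      z * (x : ℂ) ^ (c + y * Complex.I : ℂ) := by
    rw [mul_comm z, Complex.ofReal_inv, Complex.inv_cpow _ _ (by
        rw [Complex.arg_ofReal_of_nonneg hx.le]; exact Real.pi_pos.ne), ← Complex.cpow_neg, neg_neg]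
  simp_rw [smul_eq_mul, e] at h
  have hpi : (Real.pi : ℂ) ≠ 0 := by exact_mod_cast Real.pi_ne_zero
  have h1 : 2 * (Real.pi : ℂ) * ((1 / (2 * Real.pi) : ℝ) : ℂ) = 1 := by
    push_cast
    field_simp
  rw [← h, Complex.real_smul, ← mul_assoc, h1, one_mul]

/-! ### Moments of the exponential and Gamma(2) laws -/

theorem ae_stdExpMeasure_pos : ∀ᵐ v ∂stdExpMeasure, (0 : ℝ) < v :=
  (withDensity_absolutelyContinuous _ _).ae_le (ae_restrict_mem measurableSet_Ioi)

theorem ae_stdGammaTwoMeasure_pos : ∀ᵐ v ∂stdGammaTwoMeasure, (0 : ℝ) < v :=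
  (withDensity_absolutelyContinuous _ _).ae_le (ae_restrict_mem measurableSet_Ioi)

theorem ae_stdExpMeasure_prod_stdGammaTwoMeasure_pos :
    ∀ᵐ p ∂stdExpMeasure.prod stdGammaTwoMeasure, (0 : ℝ) < p.1 ∧ (0 : ℝ) < p.2 :=
  (Measure.quasiMeasurePreserving_fst.ae ae_stdExpMeasure_pos).and
    (Measure.quasiMeasurePreserving_snd.ae ae_stdGammaTwoMeasure_pos)

theorem integral_stdExpMeasure (f : ℝ → ℂ) :
    ∫ v, f v ∂stdExpMeasure = ∫ v in Ioi 0, (Real.exp (-v) : ℂ) * f v := by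
  rw [stdExpMeasure, integral_withDensity_eq_integral_toReal_smul (by fun_prop)
    (Filter.Eventually.of_forall fun _ => ENNReal.ofReal_lt_top)]
  refine setIntegral_congr_fun measurableSet_Ioi fun v _ => ?_
  rw [ENNReal.toReal_ofReal (Real.exp_pos _).le, Complex.real_smul]

theorem integral_stdGammaTwoMeasure (f : ℝ → ℂ) :
    ∫ v, f v ∂stdGammaTwoMeasure = ∫ v in Ioi 0, ((v * Real.exp (-v) : ℝ) : ℂ) * f v := by
  rw [stdGammaTwoMeasure, integral_withDensity_eq_integral_toReal_smul (by fun_prop)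
    (Filter.Eventually.of_forall fun _ => ENNReal.ofReal_lt_top)]
  refine setIntegral_congr_fun measurableSet_Ioi fun v hv => ?_
  have hv' : (0 : ℝ) < v := hv
  rw [ENNReal.toReal_ofReal (by positivity), Complex.real_smul]

theorem integral_cpow_stdExpMeasure {s : ℂ} (hs : 0 < s.re) :
    ∫ v, (v : ℂ) ^ s ∂stdExpMeasure = Complex.Gamma (s + 1) := by
  rw [integral_stdExpMeasure, Complex.Gamma_eq_integral (by simp; linarith),
    Complex.GammaIntegral]
  simp

theorem integral_cpow_stdGammaTwoMeasure {s : ℂ} (hs : 0 < s.re) :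
    ∫ v, (v : ℂ) ^ s ∂stdGammaTwoMeasure = Complex.Gamma (s + 2) := by
  rw [integral_stdGammaTwoMeasure, Complex.Gamma_eq_integral (by simp; linarith),
    Complex.GammaIntegral]
  refine setIntegral_congr_fun measurableSet_Ioi fun v hv => ?_
  have hv' : (v : ℂ) ≠ 0 := by exact_mod_cast (show (0 : ℝ) < v from hv).ne'
  rw [show s + 2 - 1 = s + 1 by ring, Complex.cpow_add _ _ hv', Complex.cpow_one]
  push_cast
  ring

theorem integrable_rpow_stdExpMeasure {c : ℝ} (hc : 0 < c) :
    Integrable (fun v : ℝ => v ^ c) stdExpMeasure := by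
  have h : Integrable (fun v : ℝ => (v : ℂ) ^ (c : ℂ)) stdExpMeasure := by
    refine Integrable.of_integral_ne_zero ?_
    rw [integral_cpow_stdExpMeasure (by simpa)]
    exact Complex.Gamma_ne_zero_of_re_pos (by simp; linarith)
  refine h.norm.congr ?_
  filter_upwards [ae_stdExpMeasure_pos] with v hv
  rw [Complex.norm_cpow_eq_rpow_re_of_pos hv, Complex.ofReal_re]

theorem integrable_rpow_stdGammaTwoMeasure {c : ℝ} (hc : 0 < c) :
    Integrable (fun v : ℝ => v ^ c) stdGammaTwoMeasure := by
  have h : Integrable (fun v : ℝ => (v : ℂ) ^ (c : ℂ)) stdGammaTwoMeasure := by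
    refine Integrable.of_integral_ne_zero ?_
    rw [integral_cpow_stdGammaTwoMeasure (by simpa)]
    exact Complex.Gamma_ne_zero_of_re_pos (by simp; linarith)
  refine h.norm.congr ?_
  filter_upwards [ae_stdGammaTwoMeasure_pos] with v hv
  rw [Complex.norm_cpow_eq_rpow_re_of_pos hv, Complex.ofReal_re]

theorem lintegral_one_stdExpMeasure : ∫⁻ _, 1 ∂stdExpMeasure = 1 := by
  rw [lintegral_stdExpMeasure measurable_const]
  simp only [mul_one]
  rw [← ofReal_integral_eq_lintegral_ofReal, integral_exp_neg_Ioi_zero, ENNReal.ofReal_one]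
  · exact integrableOn_exp_neg_Ioi 0
  · exact Filter.Eventually.of_forall fun _ => (Real.exp_pos _).le

theorem lintegral_one_stdGammaTwoMeasure : ∫⁻ _, 1 ∂stdGammaTwoMeasure = 1 := by
  rw [lintegral_stdGammaTwoMeasure measurable_const]
  simp only [mul_one]
  have e : ∀ v : ℝ, v * Real.exp (-v) = v ^ ((2 : ℝ) - 1) * Real.exp (-(1 * v)) := fun v => by
    norm_num
  simp_rw [e]
  rw [← ofReal_integral_eq_lintegral_ofReal (integrableOn_rpow_mul_exp_neg_mul two_pos one_pos),
    Real.integral_rpow_mul_exp_neg_mul_Ioi two_pos one_pos]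
  · simp
  · filter_upwards [ae_restrict_mem measurableSet_Ioi] with v hv
    have : (0 : ℝ) < v := hv
    positivity

theorem integrable_log_one_add_mul {x : ℝ} (hx : 0 < x) :
    Integrable (fun p : ℝ × ℝ => Real.log (1 + x * (p.2 * p.1)))
      (stdExpMeasure.prod stdGammaTwoMeasure) := by
  have h := ((integrable_rpow_stdExpMeasure one_pos).mul_prod
    (integrable_rpow_stdGammaTwoMeasure one_pos)).const_mul x
  refine h.mono' (Measurable.aestronglyMeasurable (by fun_prop)) ?_
  filter_upwards [ae_stdExpMeasure_prod_stdGammaTwoMeasure_pos] with p ⟨hp1, hp2⟩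
  have h0 : 0 < x * (p.2 * p.1) := by positivity
  rw [Real.norm_of_nonneg (Real.log_nonneg (by linarith)), Real.rpow_one, Real.rpow_one]
  linarith [Real.log_le_sub_one_of_pos (show 0 < 1 + x * (p.2 * p.1) by linarith)]

/-! ### The mean logarithm as a Meijer function -/

noncomputable section

/-- The mean of `log (1 + x S V)`, for independent `V` and `S` with laws `stdExpMeasure` and
`stdGammaTwoMeasure`. -/
def meanLog (x : ℝ) : ENNReal :=
  ∫⁻ v, ∫⁻ s, ENNReal.ofReal (Real.log (1 + x * (s * v))) ∂stdGammaTwoMeasure ∂stdExpMeasure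

theorem measurable_meanLog : Measurable meanLog :=
  Measurable.lintegral_prod_right' (f := fun p : ℝ × ℝ => ∫⁻ s,
    ENNReal.ofReal (Real.log (1 + p.1 * (s * p.2))) ∂stdGammaTwoMeasure)
    (Measurable.lintegral_prod_right' (f := fun p : (ℝ × ℝ) × ℝ =>
      ENNReal.ofReal (Real.log (1 + p.1.1 * (p.2 * p.1.2)))) (by fun_prop))

theorem meanLog_eq_ofReal {x : ℝ} (hx : 0 < x) : meanLog x = ENNReal.ofReal
    (∫ p, Real.log (1 + x * (p.2 * p.1)) ∂stdExpMeasure.prod stdGammaTwoMeasure) := by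
  rw [ofReal_integral_eq_lintegral_ofReal (integrable_log_one_add_mul hx), lintegral_prod]
  · rfl
  · fun_prop
  · filter_upwards [ae_stdExpMeasure_prod_stdGammaTwoMeasure_pos] with p ⟨hp1, hp2⟩
    exact Real.log_nonneg (le_add_of_nonneg_right (by positivity))

theorem toReal_meanLog {x : ℝ} (hx : 0 < x) : (meanLog x).toReal =
    ∫ p, Real.log (1 + x * (p.2 * p.1)) ∂stdExpMeasure.prod stdGammaTwoMeasure := by
  rw [meanLog_eq_ofReal hx, ENNReal.toReal_ofReal]
  refine integral_nonneg_of_ae ?_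
  filter_upwards [ae_stdExpMeasure_prod_stdGammaTwoMeasure_pos] with p ⟨hp1, hp2⟩
  exact Real.log_nonneg (le_add_of_nonneg_right (by positivity))

theorem meanLog_ne_top {x : ℝ} (hx : 0 < x) : meanLog x ≠ ⊤ := by
  rw [meanLog_eq_ofReal hx]
  exact ENNReal.ofReal_ne_top

theorem isMeijerLine_iff {c : ℝ} :
    IsMeijerLine 1 3 ![-1, 1, 1] ![1] c ↔ 0 < c ∧ c < 1 := by
  simp only [IsMeijerLine, Fin.forall_fin_succ]
  simp
  constructor
  · rintro ⟨h1, h2, h3⟩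
    exact ⟨h3, h1⟩
  · rintro ⟨h1, h2⟩
    exact ⟨h2, by linarith, h1⟩

/-- One of the two factors Γ(s) is rewritten as Γ(s + 1) / s. This separates the Mellin transform of
log (1 + 1/x) from the moments Γ(s + 1) and Γ(s + 2). -/
theorem meijerIntegrand_eq {z s : ℂ} (hs : s ≠ 0) :
    meijerIntegrand 1 3 ![-1, 1, 1] ![1] z s =
      Complex.Gamma s * Complex.Gamma (1 - s) / s * z ^ s *
        (Complex.Gamma (s + 1) * Complex.Gamma (s + 2)) := by
  simp only [meijerIntegrand, Fin.prod_univ_succ]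
  simp
  rw [Complex.Gamma_add_one s hs, show (1 : ℂ) + 1 + s = s + 2 by ring]
  field_simp

/-- Fubini for the function `F` of the height y on the line and of the pair (V, S): integrating out
the pair gives the Meijer integrand, integrating out y gives 2π log (1 + x S V). -/
theorem hasMeijerG_meanLog {x : ℝ} (hx : 0 < x) :
    HasMeijerG 1 3 ![-1, 1, 1] ![1] (x : ℂ) ((meanLog x).toReal : ℂ) := by
  refine ⟨⟨1 / 2, isMeijerLine_iff.2 (by norm_num)⟩, fun c hc => ?_⟩
  obtain ⟨hc0, hc1⟩ := isMeijerLine_iff.1 hc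
  set ρ := stdExpMeasure.prod stdGammaTwoMeasure with hρ
  set M : ℝ → ℂ := fun y => Complex.Gamma (c + y * Complex.I) *
    Complex.Gamma (1 - (c + y * Complex.I)) / (c + y * Complex.I) with hM
  have hMi : Integrable M := integrable_Gamma_mul_Gamma_one_sub_div hc0 hc1
  have hne (y : ℝ) : (c + y * Complex.I : ℂ) ≠ 0 := fun h => by
    have := congrArg Complex.re h
    simp at this
    exact hc0.ne' this
  have hpos := ae_stdExpMeasure_prod_stdGammaTwoMeasure_pos
  rw [← hρ] at hpos
  set F : ℝ × (ℝ × ℝ) → ℂ := fun q =>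
    M q.1 * ((x * (q.2.2 * q.2.1) : ℝ) : ℂ) ^ (c + q.1 * Complex.I : ℂ) with hF
  have hFi : Integrable F (volume.prod ρ) := by
    -- On the line the modulus of a power of a positive number depends only on c, so up to x^c the
    -- norm of `F` is a product of three integrable functions of separate variables.
    have hdom := hMi.norm.mul_prod ((integrable_rpow_stdExpMeasure hc0).mul_prod
      (integrable_rpow_stdGammaTwoMeasure hc0))
    refine (hdom.const_mul (x ^ c)).mono' ?_ ?_
    · exact hMi.aestronglyMeasurable.comp_fst.mul (Measurable.aestronglyMeasurable (by fun_prop))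
    · filter_upwards [Measure.quasiMeasurePreserving_snd.ae hpos] with q hq
      have := hq.1
      have := hq.2
      simp only [hF]
      rw [norm_mul, Complex.norm_cpow_eq_rpow_re_of_pos (by positivity),
        Real.mul_rpow (by positivity) (by positivity), Real.mul_rpow (by positivity) (by positivity)]
      simp only [Complex.add_re, Complex.ofReal_re, Complex.mul_re, Complex.I_re, mul_zero,
        Complex.ofReal_im, Complex.I_im, mul_one, sub_self, add_zero]
      exact le_of_eq (by ring)
  have h1 (y : ℝ) : ∫ p, F (y, p) ∂ρ =
      meijerIntegrand 1 3 ![-1, 1, 1] ![1] x (c + y * Complex.I) := by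
    have e : ∀ᵐ p ∂ρ, F (y, p) = M y * (x : ℂ) ^ (c + y * Complex.I : ℂ) *
        ((p.1 : ℂ) ^ (c + y * Complex.I : ℂ) * (p.2 : ℂ) ^ (c + y * Complex.I : ℂ)) := by
      filter_upwards [hpos] with p hp
      have h1 := hp.1
      have h2 := hp.2
      simp only [hF]
      rw [Complex.ofReal_mul, Complex.mul_cpow_ofReal_nonneg hx.le (by positivity),
        Complex.ofReal_mul, Complex.mul_cpow_ofReal_nonneg h2.le h1.le]
      ring
    rw [integral_congr_ae e, integral_const_mul, hρ, integral_prod_mul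
      (f := fun v : ℝ => (v : ℂ) ^ (c + y * Complex.I : ℂ))
      (g := fun v : ℝ => (v : ℂ) ^ (c + y * Complex.I : ℂ)),
      integral_cpow_stdExpMeasure (by simpa), integral_cpow_stdGammaTwoMeasure (by simpa),
      meijerIntegrand_eq (hne y)]
  have h2 : ∀ᵐ p ∂ρ, ∫ y, F (y, p) = 2 * Real.pi * (Real.log (1 + x * (p.2 * p.1)) : ℂ) := by
    filter_upwards [hpos] with p hp
    have h1 := hp.1
    have h2 := hp.2
    exact integral_Gamma_mul_Gamma_one_sub_div_mul_cpow hc0 hc1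
      (x := x * (p.2 * p.1)) (by positivity)
  constructor
  · exact hFi.integral_prod_left.congr (Filter.Eventually.of_forall h1)
  · simp_rw [← h1]
    rw [integral_mul_const, integral_integral_swap (f := fun y p => F (y, p)) hFi,
      integral_congr_ae h2, integral_const_mul, integral_complex_ofReal, toReal_meanLog hx, ← hρ]
    have hpi : (Real.pi : ℂ) ≠ 0 := by exact_mod_cast Real.pi_ne_zero
    have hI := Complex.I_ne_zero
    field_simp

/-- The value is unique because a separating line exists and both candidates equal the integral
along it. -/
theorem HasMeijerG.meijerG_eq {m n p q : ℕ} {a : Fin p → ℂ} {b : Fin q → ℂ} {z v : ℂ}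
    (h : HasMeijerG m n a b z v) : meijerG m n a b z = v := by
  have hex : ∃ v, HasMeijerG m n a b z v := ⟨v, h⟩
  obtain ⟨c, hc⟩ := h.1
  rw [meijerG, dif_pos hex, ← (hex.choose_spec.2 c hc).2, (h.2 c hc).2]

theorem meijerG_eq_meanLog {x : ℝ} (hx : 0 < x) :
    meijerG 1 3 ![-1, 1, 1] ![1] (x : ℂ) = ((meanLog x).toReal : ℂ) :=
  (hasMeijerG_meanLog hx).meijerG_eq

end

/-! ### Splitting the SINR and computing the capacity -/

theorem ae_expMeasure_one_div_pos {l : ℝ} (hl : 0 < l) : ∀ᵐ x ∂expMeasure (1 / l), 0 < x := by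
  have h := lintegral_expMeasure_one_div hl (F := (Iic 0).indicator 1)
    (measurable_one.indicator measurableSet_Iic)
  rw [lintegral_indicator_one measurableSet_Iic, setLIntegral_congr_fun measurableSet_Ioi
    (g := fun _ => 0) (fun u hu => by
      rw [indicator_of_notMem, mul_zero]
      simpa using mul_pos hl hu), lintegral_zero] at h
  rw [ae_iff]
  simp only [not_lt]
  exact h

/-- With u = 1 / (l t), this is the inequality 1 + u ≤ e^u. -/
theorem densityT_nonneg {l t : ℝ} (hl : 0 < l) (ht : 0 < t) : 0 ≤ densityT l t := by
  have h : densityT l t = l * (1 - (1 / (l * t) + 1) * Real.exp (-(1 / (l * t)))) := by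
    unfold densityT
    field_simp
    ring
  have h1 : (1 / (l * t) + 1) * Real.exp (-(1 / (l * t))) ≤ 1 := by
    rw [Real.exp_neg, ← div_eq_mul_inv, div_le_one (Real.exp_pos _)]
    exact Real.add_one_le_exp _
  rw [h]
  exact mul_nonneg hl.le (by linarith)

/-- Transfers the Tonelli computations, made in `ENNReal` without integrability assumptions, to
Bochner integrals. -/
theorem integrable_and_integral_of_lintegral_eq {α : Type*} [MeasurableSpace α] {μ : Measure α}
    {f : α → ℝ} {c : ENNReal} (hm : AEStronglyMeasurable f μ) (h0 : 0 ≤ᵐ[μ] f)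
    (h : ∫⁻ x, ENNReal.ofReal (f x) ∂μ = c) (hc : c ≠ ⊤) :
    Integrable f μ ∧ ∫ x, f x ∂μ = c.toReal :=
  ⟨(lintegral_ofReal_ne_top_iff_integrable hm h0).1 (h ▸ hc),
    by rw [integral_eq_lintegral_of_nonneg_ae h0 hm, h]⟩

theorem one_add_sinrAF {Ps N₀ d₁ d₂ m η α x₁ x₂ y z : ℝ}
    (hPs : 0 < Ps) (hN₀ : 0 < N₀) (hd₁ : 0 < d₁) (hd₂ : 0 < d₂) (hη : 0 < η)
    (hα₀ : 0 < α) (hα₁ : α < 1) (hx₁ : 0 < x₁) (hx₂ : 0 < x₂) (hy : 0 < y) (hz : 0 < z) :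
    1 + sinrAF Ps N₀ d₁ d₂ m η α x₁ x₂ y z =
      (1 + harvestRatio η α * (Ps / (N₀ * d₁ ^ m * d₂ ^ m)) * ((x₁ + x₂) * y)) /
      (1 + harvestRatio η α * (Ps / (N₀ * d₁ ^ m * d₂ ^ m)) * ((x₁ + x₂) * y) /
        (1 + x₁ / ((x₁ + x₂) * z) / harvestRatio η α)) := by
  unfold sinrAF harvestRatio
  have h1 := Real.rpow_pos_of_pos hd₁ m
  have h2 := Real.rpow_pos_of_pos hd₂ m
  generalize d₁ ^ m = D₁ at *
  generalize d₂ ^ m = D₂ at *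
  -- Taking β = 1 - α as the variable makes this denominator an atom known to be positive.
  obtain ⟨β, hβ, rfl⟩ : ∃ β, 0 < β ∧ α = 1 - β := ⟨1 - α, by linarith, by ring⟩
  rw [sub_sub_cancel]
  have hs : 0 < x₁ + x₂ := by positivity
  generalize x₁ + x₂ = S at *
  field_simp
  ring

theorem log_one_add_sinrAF {Ps N₀ d₁ d₂ m η α x₁ x₂ y z : ℝ}
    (hPs : 0 < Ps) (hN₀ : 0 < N₀) (hd₁ : 0 < d₁) (hd₂ : 0 < d₂) (hη : 0 < η)
    (hα₀ : 0 < α) (hα₁ : α < 1) (hx₁ : 0 < x₁) (hx₂ : 0 < x₂) (hy : 0 < y) (hz : 0 < z) :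
    Real.log (1 + sinrAF Ps N₀ d₁ d₂ m η α x₁ x₂ y z) =
      Real.log (1 + harvestRatio η α * (Ps / (N₀ * d₁ ^ m * d₂ ^ m)) * ((x₁ + x₂) * y)) -
      Real.log (1 + harvestRatio η α * (Ps / (N₀ * d₁ ^ m * d₂ ^ m)) * ((x₁ + x₂) * y) /
        (1 + x₁ / ((x₁ + x₂) * z) / harvestRatio η α)) := by
  have hk : 0 < harvestRatio η α := div_pos (mul_pos hη hα₀) (by linarith)
  rw [one_add_sinrAF hPs hN₀ hd₁ hd₂ hη hα₀ hα₁ hx₁ hx₂ hy hz, Real.log_div] <;> positivity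

theorem proposition9 {Ω : Type*} [MeasurableSpace Ω] (μ : Measure Ω) [IsProbabilityMeasure μ]
    (Ps N₀ d₁ d₂ m η α ls ld lr k a : ℝ)
    (hPs : 0 < Ps) (hN₀ : 0 < N₀) (hd₁ : 0 < d₁) (hd₂ : 0 < d₂) (hη : 0 < η)
    (hα₀ : 0 < α) (hα₁ : α < 1) (hls : 0 < ls) (hld : 0 < ld) (hlr : 0 < lr)
    (hk : k = harvestRatio η α) (ha : a = Ps / (N₀ * d₁ ^ m * d₂ ^ m))
    (h₁ h₂ g f : Ω → ℂ)
    (hh₁ : HasLaw (fun ω => ‖h₁ ω‖ ^ 2) (expMeasure (1 / ls)) μ)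
    (hh₂ : HasLaw (fun ω => ‖h₂ ω‖ ^ 2) (expMeasure (1 / ls)) μ)
    (hg : HasLaw (fun ω => ‖g ω‖ ^ 2) (expMeasure (1 / ld)) μ)
    (hf : HasLaw (fun ω => ‖f ω‖ ^ 2) (expMeasure (1 / lr)) μ)
    (hind : iIndepFun (![fun ω => ‖h₁ ω‖ ^ 2, fun ω => ‖h₂ ω‖ ^ 2, fun ω => ‖g ω‖ ^ 2,
      fun ω => ‖f ω‖ ^ 2] : Fin 4 → Ω → ℝ) μ) :
    (∀ x : ℝ, 0 < x →
      HasMeijerG 1 3 ![-1, 1, 1] ![1] (x : ℂ) (meijerG 1 3 ![-1, 1, 1] ![1] (x : ℂ))) ∧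
    Integrable (fun ω => Real.logb 2 (1 + sinrAF Ps N₀ d₁ d₂ m η α
      (‖h₁ ω‖ ^ 2) (‖h₂ ω‖ ^ 2) (‖g ω‖ ^ 2) (‖f ω‖ ^ 2))) μ ∧
    IntegrableOn (fun t : ℝ =>
      meijerG 1 3 ![-1, 1, 1] ![1] ((k * a * ls * ld / (1 + t / k) : ℝ) : ℂ) *
        (densityT lr t : ℂ)) (Ioi 0) ∧
    ((∫ ω, Real.logb 2 (1 + sinrAF Ps N₀ d₁ d₂ m η α
      (‖h₁ ω‖ ^ 2) (‖h₂ ω‖ ^ 2) (‖g ω‖ ^ 2) (‖f ω‖ ^ 2)) ∂μ : ℝ) : ℂ) =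
      1 / (Real.log 2 : ℂ) * meijerG 1 3 ![-1, 1, 1] ![1] ((k * a * ls * ld : ℝ) : ℂ) -
      1 / (Real.log 2 : ℂ) * ∫ t in Ioi (0 : ℝ),
        meijerG 1 3 ![-1, 1, 1] ![1] ((k * a * ls * ld / (1 + t / k) : ℝ) : ℂ) *
          (densityT lr t : ℂ) := by
  have hk0 : 0 < k := hk ▸ div_pos (mul_pos hη hα₀) (by linarith)
  have ha0 : 0 < a := ha ▸ by positivity
  have hx0 : 0 < k * a * ls * ld := by positivity
  refine ⟨fun x hx => by rw [meijerG_eq_meanLog hx]; exact hasMeijerG_meanLog hx, ?_⟩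
  set X₁ : Ω → ℝ := fun ω => ‖h₁ ω‖ ^ 2
  set X₂ : Ω → ℝ := fun ω => ‖h₂ ω‖ ^ 2
  set Y : Ω → ℝ := fun ω => ‖g ω‖ ^ 2
  set Z : Ω → ℝ := fun ω => ‖f ω‖ ^ 2
  have hm₁ : AEMeasurable X₁ μ := hh₁.aemeasurable
  have hm₂ : AEMeasurable X₂ μ := hh₂.aemeasurable
  have hm₃ : AEMeasurable Y μ := hg.aemeasurable
  have hm₄ : AEMeasurable Z μ := hf.aemeasurable
  have hpos : ∀ᵐ ω ∂μ, 0 < X₁ ω ∧ 0 < X₂ ω ∧ 0 < Y ω ∧ 0 < Z ω := by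
    filter_upwards [ae_of_ae_map hm₁ (hh₁.map_eq ▸ ae_expMeasure_one_div_pos hls),
      ae_of_ae_map hm₂ (hh₂.map_eq ▸ ae_expMeasure_one_div_pos hls),
      ae_of_ae_map hm₃ (hg.map_eq ▸ ae_expMeasure_one_div_pos hld),
      ae_of_ae_map hm₄ (hf.map_eq ▸ ae_expMeasure_one_div_pos hlr)] with ω a b c d
    exact ⟨a, b, c, d⟩
  set A : Ω → ℝ := fun ω => Real.log (1 + k * a * ((X₁ ω + X₂ ω) * Y ω)) with hA
  set B : Ω → ℝ := fun ω => Real.log (1 + k * a * ((X₁ ω + X₂ ω) * Y ω) /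
    (1 + X₁ ω / ((X₁ ω + X₂ ω) * Z ω) / k)) with hB
  have hAB : ∀ᵐ ω ∂μ, A ω - B ω =
      Real.log (1 + sinrAF Ps N₀ d₁ d₂ m η α (X₁ ω) (X₂ ω) (Y ω) (Z ω)) := by
    filter_upwards [hpos] with ω ⟨p1, p2, p3, p4⟩
    rw [log_one_add_sinrAF hPs hN₀ hd₁ hd₂ hη hα₀ hα₁ p1 p2 p3 p4, hA, hB, hk, ha]
  have hA0 : 0 ≤ᵐ[μ] A := by
    filter_upwards [hpos] with ω ⟨p1, p2, p3, p4⟩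
    exact Real.log_nonneg (le_add_of_nonneg_right (by positivity))
  have hB0 : 0 ≤ᵐ[μ] B := by
    filter_upwards [hpos] with ω ⟨p1, p2, p3, p4⟩
    exact Real.log_nonneg (le_add_of_nonneg_right (by positivity))
  have hBA : ∀ᵐ ω ∂μ, B ω ≤ A ω := by
    filter_upwards [hpos] with ω ⟨p1, p2, p3, p4⟩
    refine Real.log_le_log (by positivity) (add_le_add_right (div_le_self (by positivity) ?_) _)
    exact le_add_of_nonneg_right (by positivity)
  -- The total mass of the law of T comes from testing the joint law on the constant 1; no integral
  -- of `densityT` has to be evaluated.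
  have hρ : ∫⁻ _, 1 ∂ratioMeasure lr = 1 := by
    have h := lintegral_sum_gain_ratio hls hld hlr hh₁ hh₂ hg hf hind (Φ := fun _ _ _ => 1)
      measurable_const
    simp_rw [lintegral_one_stdGammaTwoMeasure, lintegral_one_stdExpMeasure] at h
    rw [← h]
    simp
  have hAl : ∫⁻ ω, ENNReal.ofReal (A ω) ∂μ = meanLog (k * a * ls * ld) := by
    rw [hA, lintegral_sum_gain_ratio hls hld hlr hh₁ hh₂ hg hf hind
      (Φ := fun s y _ => ENNReal.ofReal (Real.log (1 + k * a * (s * y)))) (by fun_prop)]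
    have e (v s : ℝ) : k * a * (ls * s * (ld * v)) = k * a * ls * ld * (s * v) := by ring
    simp_rw [e]
    change ∫⁻ t, meanLog (k * a * ls * ld) ∂ratioMeasure lr = _
    rw [← mul_one (meanLog _), lintegral_const_mul _ measurable_const, hρ]
  have hBl : ∫⁻ ω, ENNReal.ofReal (B ω) ∂μ =
      ∫⁻ t, meanLog (k * a * ls * ld / (1 + t / k)) ∂ratioMeasure lr := by
    rw [hB, lintegral_sum_gain_ratio hls hld hlr hh₁ hh₂ hg hf hind
      (Φ := fun s y t => ENNReal.ofReal (Real.log (1 + k * a * (s * y) / (1 + t / k))))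
      (by fun_prop)]
    have e (t v s : ℝ) : k * a * (ls * s * (ld * v)) / (1 + t / k) =
      k * a * ls * ld / (1 + t / k) * (s * v) := by ring
    simp_rw [e]
    rfl
  have hBtop : ∫⁻ t, meanLog (k * a * ls * ld / (1 + t / k)) ∂ratioMeasure lr ≠ ⊤ := by
    rw [← hBl]
    -- Since 1 + T / k ≥ 1, the second logarithm is at most the first, whose mean is finite.
    refine ne_top_of_le_ne_top (meanLog_ne_top hx0) (hAl ▸ lintegral_mono_ae ?_)
    filter_upwards [hBA] with ω h using ENNReal.ofReal_le_ofReal h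
  obtain ⟨iA, eA⟩ := integrable_and_integral_of_lintegral_eq
    (AEMeasurable.aestronglyMeasurable (by fun_prop)) hA0 hAl (meanLog_ne_top hx0)
  obtain ⟨iB, eB⟩ := integrable_and_integral_of_lintegral_eq
    (AEMeasurable.aestronglyMeasurable (by fun_prop)) hB0 hBl hBtop
  have hmean : Measurable fun t => meanLog (k * a * ls * ld / (1 + t / k)) :=
    measurable_meanLog.comp (by fun_prop)
  have hpt (t : ℝ) (ht : t ∈ Ioi (0 : ℝ)) : 0 < k * a * ls * ld / (1 + t / k) := by
    have : (0 : ℝ) < t := ht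
    positivity
  obtain ⟨iT, eT⟩ := integrable_and_integral_of_lintegral_eq (μ := volume.restrict (Ioi 0))
    (f := fun t => (meanLog (k * a * ls * ld / (1 + t / k))).toReal * densityT lr t)
    (hmean.ennreal_toReal.mul (measurable_densityT lr)).aestronglyMeasurable
    (by
      filter_upwards [ae_restrict_mem measurableSet_Ioi] with t ht
      exact mul_nonneg ENNReal.toReal_nonneg (densityT_nonneg hlr ht))
    (by
      rw [lintegral_ratioMeasure lr hmean]
      refine setLIntegral_congr_fun measurableSet_Ioi fun t ht => ?_
      rw [ENNReal.ofReal_mul ENNReal.toReal_nonneg, ENNReal.ofReal_toReal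
        (meanLog_ne_top (hpt t ht)), mul_comm]) hBtop
  have hG (t : ℝ) (ht : t ∈ Ioi (0 : ℝ)) :
      (((meanLog (k * a * ls * ld / (1 + t / k))).toReal * densityT lr t : ℝ) : ℂ) =
      meijerG 1 3 ![-1, 1, 1] ![1] ((k * a * ls * ld / (1 + t / k) : ℝ) : ℂ) *
        (densityT lr t : ℂ) := by
    rw [meijerG_eq_meanLog (hpt t ht), Complex.ofReal_mul]
  have hlog : ∀ᵐ ω ∂μ, (A ω - B ω) / Real.log 2 = Real.logb 2
      (1 + sinrAF Ps N₀ d₁ d₂ m η α (X₁ ω) (X₂ ω) (Y ω) (Z ω)) := by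
    filter_upwards [hAB] with ω h
    rw [h, Real.logb]
  refine ⟨((iA.sub iB).div_const _).congr hlog,
    IntegrableOn.congr_fun iT.ofReal hG measurableSet_Ioi, ?_⟩
  rw [← integral_congr_ae hlog, integral_div, integral_sub iA iB, eA, eB,
    ← setIntegral_congr_fun measurableSet_Ioi hG, integral_complex_ofReal, eT,
    meijerG_eq_meanLog hx0]
  push_cast
  ring
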